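/- Let $B$ be a real F-space (a real topological vector space whose topology is given by a complete translation-invariant metric), let $X$ be a $B$-valued (Borel measurable) random vector with law $\mu$, defined on a probability space $(\Omega,\mathcal F,P)$, and let $X_1,X_2,\ldots$ be i.i.d. copies of $X$ on the same space. Put $\mu_n=\frac1n\sum_{j=1}^n\delta_{X_j}$. For a class $\mathcal{T}$ of Borel functionals on a space $E$, a point $a\in E$ and a probability measure $\nu$ on $E$, the half space depth is $$HD_{\mathcal T}(a,\nu)=\inf_{\tau\in\mathcal T}\nu(\{x:\tau(x)\ge \tau(a)\});$$ $HD_{\mathbb R^d}$ denotes this depth when $E=\mathbb R^d$ and $\mathcal T$ is the set of all linear functionals on $\mathbb R^d$. Let $t_k:B\to\mathbb R$, $k\ge1$, be Borel functionals such that $\{t_k(X):k\ge 1\}$ are independent with mean zero and variances $\sigma_k^2\in(0,\infty)$ (with $\sigma_k>0$), and such that $$\liminf_{k\to\infty}P(t_k(X)<c_k)>0\quad\text{for all real sequences } (c_k) \text{ with } \lim_{k\to\infty} c_k/\sigma_k=0.$$ Let $\mathcal T$ be the set of all finite linear combinations of $\{t_k:k\ge1\}$, and let $a\in B$. Assume that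 either both (A-I) and (A-II), or (A-III), hold, where: (A-I) for all integers $d\ge1$, $HD_{\mathbb R^d}(\Pi_d(a),\mu^{\Pi_d})>0$, where $\Pi_d=(t_1,\ldots,t_d)$ and $\mu^{\Pi_d}$ is the image of $\mu$ under $\Pi_d$; (A-II) for some constant $c<\infty$, $\mathbb E(t_k^4(X))\le c\,[\mathbb E(t_k^2(X))]^2$ for all $k\ge1$; (A-III) for some $0<\lambda_k<\infty$, the variables $\{t_k(X)/\lambda_k:k\ge1\}$ are i.i.d. with a probability density $\phi$ that is positive almost everywhere and absolutely continuous on every compact interval of $\mathbb{R}$, with $\int_{\mathbb R}\frac{(\phi'(x))^2}{\phi(x)}\,dx<\infty$ and $\int_{\mathbb R}x^2\phi(x)\,dx<\infty$. Then: (i) if $\sum_{k\ge1}t_k^2(a)/\sigma_k^2<\infty$, then with probability one $HD_{\mathcal T}(a,\mu_n)=0$ for all $n\ge1$, while $HD_{\mathcal T}(a,\mu)>0$; hence consistency fails at $a$: with probability one $HD_{\mathcal T}(a,\mu_n)$ does not converge to $HD_{\mathcal T}(a,\mu)$; (ii) if $\sum_{k\ge1}t_k^2(a)/\sigma_k^2=\infty$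 but $\lim_{k\to\infty}t_k(a)/\sigma_k=0$, then consistency holds at $a$: with probability one $HD_{\mathcal T}(a,\mu_n)\to HD_{\mathcal T}(a,\mu)$ as $n\to\infty$. -/

import Mathlib

open MeasureTheory ProbabilityTheory Filter Topology
open scoped ENNReal

namespace HalfSpaceDepth

noncomputable section

/-- The half space depth of `a` with respect to the class of functionals `T` and the
measure `μ`: the infimum over `τ ∈ T` of `μ {x | τ x ≥ τ a}`. -/
def depth {E : Type*} [MeasurableSpace E] (T : Set (E → ℝ)) (a : E) (μ : Measure E) : ℝ≥0∞ :=
  ⨅ τ ∈ T, μ {x | τ a ≤ τ x}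

/-- The empirical measure `(1 / n) * ∑ δ_{Y j}` of the first `n` sample points. -/
def empiricalMeasure {E : Type*} [MeasurableSpace E] (Y : ℕ → E) (n : ℕ) : Measure E :=
  (n : ℝ≥0∞)⁻¹ • ∑ j ∈ Finset.range n, Measure.dirac (Y j)

/-- All finite linear combinations `∑ k, α k * t k` of the functionals `t k`. -/
def finiteCombinations {E : Type*} (t : ℕ → E → ℝ) : Set (E → ℝ) :=
  Set.range fun (α : ℕ →₀ ℝ) (x : E) => α.sum fun k r => r * t k x

/-- All linear functionals on `ℝ^d`; with `depth` they give the Tukey half space depth. -/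
def linearFunctionals (d : ℕ) : Set ((Fin d → ℝ) → ℝ) :=
  Set.range fun (L : (Fin d → ℝ) →ₗ[ℝ] ℝ) (x : Fin d → ℝ) => L x

/-- The map `x ↦ (t 0 x, …, t (d - 1) x)` into `ℝ^d`. -/
def firstCoords {E : Type*} (t : ℕ → E → ℝ) (d : ℕ) (x : E) : Fin d → ℝ :=
  fun i => t i x

/-- Assumption (A-I) at the point `a`: for every `d ≥ 1`, the image of `a` in `ℝ^d` has
positive Tukey half space depth with respect to the image of `μ` on `ℝ^d`. -/
def AssumptionI {E : Type*} [MeasurableSpace E] (t : ℕ → E → ℝ) (μ : Measure E) (a : E) : Prop :=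
  ∀ d : ℕ, 1 ≤ d →
    0 < depth (linearFunctionals d) (firstCoords t d a) (μ.map (firstCoords t d))

/-- Assumption (A-II) for a sequence of real random variables: uniformly bounded kurtosis,
`E (ξ k) ^ 4 ≤ c * (E (ξ k) ^ 2) ^ 2` with finite fourth moments. -/
def AssumptionII {Ω : Type*} [MeasurableSpace Ω] (ξ : ℕ → Ω → ℝ) (P : Measure Ω) : Prop :=
  ∃ c : ℝ, ∀ k, Integrable (fun ω => ξ k ω ^ 4) P ∧
    ∫ ω, ξ k ω ^ 4 ∂P ≤ c * (∫ ω, ξ k ω ^ 2 ∂P) ^ 2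

/-- Assumption (A-III) for a sequence of real random variables: for some scalings `lam k > 0` the
`ξ k / lam k` are i.i.d. with a probability density `φ` that is a.e. positive, absolutely
continuous on compact intervals, and has finite Fisher information and finite second moment. -/
def AssumptionIII {Ω : Type*} [MeasurableSpace Ω] (ξ : ℕ → Ω → ℝ) (P : Measure Ω) : Prop :=
  ∃ (lam : ℕ → ℝ) (φ : ℝ → ℝ),
    (∀ k, 0 < lam k) ∧
    iIndepFun (fun k ω => ξ k ω / lam k) P ∧
    (∀ k, P.map (fun ω => ξ k ω / lam k) = volume.withDensity fun x => ENNReal.ofReal (φ x)) ∧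
    (∀ᵐ x : ℝ, 0 < φ x) ∧
    (∀ a b : ℝ, AbsolutelyContinuousOnInterval φ a b) ∧
    Integrable (fun x : ℝ => deriv φ x ^ 2 / φ x) ∧
    Integrable (fun x : ℝ => x ^ 2 * φ x)

end

end HalfSpaceDepth

namespace HalfSpaceDepth

/-! With `Y k = t k (X) / σ k` and `b k = t k a / σ k`, everything concerns half-spaces through `b`
for the law of the independent standardized sequence `Y`.

Whenever `b k → 0`, the empirical depth is almost surely zero for every `n`: the events `t k (X) < t
k a` are independent in `k` with probability eventually bounded below, so by the second
Borel–Cantelli lemma some single `t k` puts all `n` sample points strictly below `a`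
(`ae_exists_forall_mem`). Hence only the population depth matters, and it is positive or zero
according to whether `∑ b k ^ 2` converges.

If the series diverges, Chebyshev applied to `∑ b k * Y k` gives half-spaces of vanishing
probability (`measure_sum_mul_self_le`). If it converges, cut at a large `d`. The first `d`
coordinates are controlled by (A-I), or by the positive density in (A-III). In the tail,
Cauchy–Schwarz bounds `∑ α k * b k` by `ε` times the norm of `α`, which the random sum exceeds with
probability at least a fixed `p` (`exists_le_measureReal_sum_ge`); independence multiplies the two
bounds. That anti-concentration needs only characteristic function decay near the origin, uniform in
`k`: it bounds `E|S|` below for normalized sums `S`. -/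

/-! ### Anti-concentration of weighted sums -/

/-- Paley–Zygmund type bound: a centered variable with second moment at most one and first absolute
moment at least `c` exceeds `c / 4` with probability at least `c ^ 2 / 16`. -/
lemma measureReal_ge_of_integral_abs_ge {Ω : Type*} [MeasurableSpace Ω] {P : Measure Ω}
    [IsProbabilityMeasure P] {S : Ω → ℝ} (hS : Measurable S) (hS2 : MemLp S 2 P)
    (h0 : ∫ ω, S ω ∂P = 0) (h1 : ∫ ω, S ω ^ 2 ∂P ≤ 1) {c : ℝ} (hc : 0 < c)
    (habs : c ≤ ∫ ω, |S ω| ∂P) : c ^ 2 / 16 ≤ P.real {ω | c / 4 ≤ S ω} := by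
  have hint : Integrable S P := hS2.integrable (by norm_num)
  have hsq : Integrable (fun ω => S ω ^ 2) P := hS2.integrable_sq
  have hA : MeasurableSet {ω | c / 4 ≤ S ω} := measurableSet_le measurable_const hS
  have hind : Integrable ({ω | c / 4 ≤ S ω}.indicator (fun _ => (1 : ℝ))) P :=
    (integrable_const 1).indicator hA
  -- The left side is the positive part of `S`, with mean `E|S| / 2` because `S` is centered. On the
  -- event, completing a square gives `S ≤ c / 8 * S ^ 2 + 2 / c`; off it, `c / 4` suffices.
  have hpt : ∀ ω, (|S ω| + S ω) / 2 ≤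
      c / 4 + (c / 8 * S ω ^ 2 + 2 / c * {ω | c / 4 ≤ S ω}.indicator (fun _ => (1 : ℝ)) ω) := by
    intro ω
    by_cases h : c / 4 ≤ S ω
    · rw [Set.indicator_of_mem (by exact h), abs_of_nonneg (by linarith)]
      have : c / 8 * S ω ^ 2 + 2 / c * 1 - S ω = (c * S ω - 4) ^ 2 / (8 * c) := by
        field_simp; ring
      have : 0 ≤ (c * S ω - 4) ^ 2 / (8 * c) := by positivity
      linarith
    · rw [Set.indicator_of_notMem (by exact h)]
      have : 0 ≤ c / 8 * S ω ^ 2 := by positivity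
      rcases abs_cases (S ω) with h' | h' <;> linarith
  have hle := integral_mono ((hint.abs.add hint).div_const 2)
    ((integrable_const (c / 4)).add ((hsq.const_mul (c / 8)).add (hind.const_mul (2 / c)))) hpt
  have e1 : ∫ ω, (|S ω| + S ω) / 2 ∂P = (∫ ω, |S ω| ∂P) / 2 := by
    rw [integral_div, integral_add hint.abs hint, h0, add_zero]
  have e2 : ∫ ω, (c / 4 + (c / 8 * S ω ^ 2 +
      2 / c * {ω | c / 4 ≤ S ω}.indicator (fun _ => (1 : ℝ)) ω)) ∂P =
      c / 4 + (c / 8 * ∫ ω, S ω ^ 2 ∂P + 2 / c * P.real {ω | c / 4 ≤ S ω}) := by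
    have hi : Integrable (fun ω => c / 8 * S ω ^ 2 +
        2 / c * {ω | c / 4 ≤ S ω}.indicator (fun _ => (1 : ℝ)) ω) P :=
      (hsq.const_mul _).add (hind.const_mul _)
    rw [integral_add (integrable_const _) hi, integral_add (hsq.const_mul _) (hind.const_mul _), integral_const_mul, integral_const_mul,
      integral_indicator_const _ hA]
    simp
  have hle' : (∫ ω, |S ω| ∂P) / 2 ≤
      c / 4 + (c / 8 * ∫ ω, S ω ^ 2 ∂P + 2 / c * P.real {ω | c / 4 ≤ S ω}) := by
    rw [← e1, ← e2]; exact hle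
  have h3 : c / 8 * ∫ ω, S ω ^ 2 ∂P ≤ c / 8 := by nlinarith
  have h4 : c / 8 ≤ 2 / c * P.real {ω | c / 4 ≤ S ω} := by linarith
  have h5 := mul_le_mul_of_nonneg_left h4 (by positivity : (0 : ℝ) ≤ c / 2)
  have h6 : c / 2 * (2 / c * P.real {ω | c / 4 ≤ S ω}) = P.real {ω | c / 4 ≤ S ω} := by
    field_simp
  rw [h6] at h5
  linarith

/-- The characteristic function at `u` differs from `1` by at most `|u| * E|S|`. -/
lemma norm_charFun_sub_one_le {Ω : Type*} [MeasurableSpace Ω] {P : Measure Ω}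
    [IsProbabilityMeasure P] {S : Ω → ℝ} (hS : Measurable S) (hint : Integrable S P) (u : ℝ) :
    ‖charFun (P.map S) u - 1‖ ≤ |u| * ∫ ω, |S ω| ∂P := by
  rw [charFun_apply_real, integral_map hS.aemeasurable (by fun_prop)]
  have hb : Integrable (fun ω => Complex.exp (u * S ω * Complex.I)) P := by
    refine Integrable.of_bound (by fun_prop) 1 (ae_of_all _ fun ω => ?_)
    rw [← Complex.ofReal_mul, Complex.norm_exp_ofReal_mul_I]
  have : ∫ ω, Complex.exp (u * S ω * Complex.I) ∂P - 1 =
      ∫ ω, (Complex.exp (u * S ω * Complex.I) - 1) ∂P := by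
    rw [integral_sub hb (integrable_const _)]; simp
  rw [this, ← integral_const_mul]
  refine norm_integral_le_of_norm_le (hint.abs.const_mul _) (ae_of_all _ fun ω => ?_)
  have := Real.norm_exp_I_mul_ofReal_sub_one_le (x := u * S ω)
  rw [mul_comm]
  simpa [abs_mul, mul_comm] using this

/-- For `|x| ≤ 1` this is the Taylor remainder with `e ≤ 4`; for `|x| ≥ 1` no cancellation is
needed, as `2 + |x| + |x| ^ 2 / 2 ≤ 4 * |x| ^ 3`. -/
lemma norm_exp_mul_I_sub_le (x : ℝ) :
    ‖Complex.exp (x * Complex.I) - (1 + x * Complex.I - x ^ 2 / 2)‖ ≤ 4 * |x| ^ 3 := by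
  rcases le_total |x| 1 with h | h
  · have := Complex.norm_exp_sub_sum_le_norm_mul_exp (x * Complex.I) 3
    simp only [Finset.sum_range_succ, Finset.sum_range_zero, mul_pow, Complex.I_sq, norm_mul,
      Complex.norm_I, mul_one, Complex.norm_real, Real.norm_eq_abs] at this
    have he : Real.exp |x| ≤ 4 := by
      have := Real.exp_le_exp.2 h
      have := Real.exp_one_lt_d9
      linarith
    calc _ = _ := by
          congr 1
          norm_num [Nat.factorial]
          ring
      _ ≤ _ := this
      _ ≤ |x| ^ 3 * 4 := by gcongr
      _ = _ := by ring
  · have h1 : ‖Complex.exp (x * Complex.I)‖ = 1 := Complex.norm_exp_ofReal_mul_I x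
    have h2 : ‖(1 + x * Complex.I - x ^ 2 / 2 : ℂ)‖ ≤ 1 + |x| + |x| ^ 2 / 2 := by
      refine (norm_sub_le _ _).trans (add_le_add ((norm_add_le _ _).trans ?_) ?_)
      · simp
      · simp
    refine (norm_sub_le _ _).trans ?_
    rw [h1]
    nlinarith [sq_nonneg |x|, mul_nonneg (sq_nonneg |x|) (sub_nonneg.2 h)]

/-- Quantitative second order Taylor expansion of the characteristic function of a centered
variable with unit variance and finite fourth moment. -/
lemma norm_charFun_sub_le_of_fourth_moment {Ω : Type*} [MeasurableSpace Ω] {P : Measure Ω}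
    [IsProbabilityMeasure P] {Y : Ω → ℝ} (hY : Measurable Y) (hY2 : MemLp Y 2 P)
    (h0 : ∫ ω, Y ω ∂P = 0) (h1 : ∫ ω, Y ω ^ 2 ∂P = 1) (h4 : Integrable (fun ω => Y ω ^ 4) P)
    {C : ℝ} (hC : ∫ ω, Y ω ^ 4 ∂P ≤ C) (u : ℝ) :
    ‖charFun (P.map Y) u - (1 - u ^ 2 / 2)‖ ≤ 4 * (1 + C) * |u| ^ 3 := by
  have hint : Integrable Y P := hY2.integrable (by norm_num)
  have hsq : Integrable (fun ω => Y ω ^ 2) P := hY2.integrable_sq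
  rw [charFun_apply_real, integral_map hY.aemeasurable (by fun_prop)]
  have hb : Integrable (fun ω => Complex.exp (u * Y ω * Complex.I)) P := by
    refine Integrable.of_bound (by fun_prop) 1 (ae_of_all _ fun ω => ?_)
    rw [← Complex.ofReal_mul, Complex.norm_exp_ofReal_mul_I]
  have hi1 : Integrable (fun ω => (u * Complex.I) * (Y ω : ℂ)) P := hint.ofReal.const_mul _
  have hi2 : Integrable (fun ω => (u ^ 2 / 2 : ℂ) * ((Y ω ^ 2 : ℝ) : ℂ)) P :=
    hsq.ofReal.const_mul _
  have e : ∫ ω, Complex.exp (u * Y ω * Complex.I) ∂P - (1 - u ^ 2 / 2) =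
      ∫ ω, (Complex.exp (u * Y ω * Complex.I) -
        ((1 + (u * Complex.I) * (Y ω : ℂ)) - (u ^ 2 / 2 : ℂ) * ((Y ω ^ 2 : ℝ) : ℂ))) ∂P := by
    have hi3 : Integrable (fun ω => 1 + (u * Complex.I) * (Y ω : ℂ)) P :=
      (integrable_const _).add hi1
    have hi4 : Integrable (fun ω => (1 + (u * Complex.I) * (Y ω : ℂ)) -
        (u ^ 2 / 2 : ℂ) * ((Y ω ^ 2 : ℝ) : ℂ)) P := hi3.sub hi2
    rw [integral_sub hb hi4, integral_sub hi3 hi2, integral_add (integrable_const _) hi1,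
      integral_const_mul, integral_const_mul, integral_complex_ofReal, integral_complex_ofReal,
      h0, h1]
    simp
  rw [e]
  -- `|y| ^ 3 ≤ y ^ 2 + y ^ 4` trades the third absolute moment for the two moments at hand.
  have hbd : ∀ ω, ‖Complex.exp (u * Y ω * Complex.I) -
        ((1 + (u * Complex.I) * (Y ω : ℂ)) - (u ^ 2 / 2 : ℂ) * ((Y ω ^ 2 : ℝ) : ℂ))‖ ≤
      4 * |u| ^ 3 * (Y ω ^ 2 + Y ω ^ 4) := by
    intro ω
    have := norm_exp_mul_I_sub_le (u * Y ω)
    calc _ = _ := by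
          congr 1
          push_cast
          ring
      _ ≤ _ := this
      _ = 4 * |u| ^ 3 * |Y ω| ^ 3 := by rw [abs_mul]; ring
      _ ≤ _ := by
          gcongr
          have e2 : Y ω ^ 2 = |Y ω| ^ 2 := (sq_abs _).symm
          have e4 : Y ω ^ 4 = |Y ω| ^ 4 := by rw [← abs_pow, abs_of_nonneg (by positivity)]
          rw [e2, e4]
          nlinarith [mul_nonneg (sq_nonneg |Y ω|) (sq_nonneg (|Y ω| - 1)), sq_nonneg (|Y ω|),
            sq_nonneg (|Y ω| ^ 2)]
  refine (norm_integral_le_of_norm_le ((hsq.add h4).const_mul _) (ae_of_all _ hbd)).trans ?_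
  rw [integral_const_mul]
  have : ∫ ω, (Y ω ^ 2 + Y ω ^ 4) ∂P ≤ 1 + C := by
    rw [integral_add hsq h4, h1]; linarith
  refine (mul_le_mul_of_nonneg_left this (by positivity)).trans (le_of_eq ?_)
  ring

/-- Half of the quadratic term absorbs the error. The exponential form is chosen because it
multiplies well over independent coordinates. -/
lemma norm_le_exp_of_norm_sub_le {z : ℂ} {u : ℝ} (hu : |u| ≤ 1)
    (h : ‖z - (1 - u ^ 2 / 2)‖ ≤ u ^ 2 / 4) : ‖z‖ ≤ Real.exp (-(u ^ 2 / 4)) := by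
  have h1 : ‖(1 - u ^ 2 / 2 : ℂ)‖ = 1 - u ^ 2 / 2 := by
    have : (1 - u ^ 2 / 2 : ℂ) = ((1 - u ^ 2 / 2 : ℝ) : ℂ) := by push_cast; ring
    rw [this, Complex.norm_real, Real.norm_of_nonneg]
    have := (sq_le_one_iff_abs_le_one u).2 hu
    linarith
  have h2 := norm_le_norm_sub_add z (1 - u ^ 2 / 2 : ℂ)
  have h3 := Real.add_one_le_exp (-(u ^ 2 / 4))
  linarith

/-- Anti-concentration for weighted sums of independent standardized variables whose
characteristic functions have a common Gaussian-type bound near the origin. -/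
lemma exists_le_measureReal_sum_ge {Ω : Type*} [MeasurableSpace Ω] {P : Measure Ω}
    [IsProbabilityMeasure P] {Y : ℕ → Ω → ℝ} (hY : ∀ k, Measurable (Y k)) (hind : iIndepFun Y P)
    (hY2 : ∀ k, MemLp (Y k) 2 P) (h0 : ∀ k, ∫ ω, Y k ω ∂P = 0)
    (h1 : ∀ k, variance (Y k) P = 1) {u₀ : ℝ} (hu₀ : 0 < u₀)
    (hchar : ∀ k u, |u| ≤ u₀ → ‖charFun (P.map (Y k)) u‖ ≤ Real.exp (-(u ^ 2 / 4))) :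
    ∃ ε p : ℝ, 0 < ε ∧ 0 < p ∧ ∀ (s : Finset ℕ) (α : ℕ → ℝ),
      p ≤ P.real {ω | ε * √(∑ k ∈ s, α k ^ 2) ≤ ∑ k ∈ s, α k * Y k ω} := by
  have hexp : Real.exp (-(u₀ ^ 2 / 4)) < 1 := by
    rw [Real.exp_lt_one_iff]; have := pow_pos hu₀ 2; linarith
  -- The lower bound for `E|S|` obtained by comparing `|1 - charFun u₀| ≤ u₀ * E|S|` with `|charFun
  -- u₀| ≤ exp (-(u₀ ^ 2 / 4))`.
  set c : ℝ := (1 - Real.exp (-(u₀ ^ 2 / 4))) / u₀ with hc_def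
  have hc : 0 < c := div_pos (by linarith) hu₀
  have key : ∀ (s : Finset ℕ) (α : ℕ → ℝ), ∑ k ∈ s, α k ^ 2 = 1 →
      c ^ 2 / 16 ≤ P.real {ω | c / 4 ≤ ∑ k ∈ s, α k * Y k ω} := by
    intro s α hα
    have hm : ∀ k, Measurable (fun ω => α k * Y k ω) := fun k => (hY k).const_mul _
    have hL : ∀ k, MemLp (fun ω => α k * Y k ω) 2 P := fun k => (hY2 k).const_mul _
    have hind' : iIndepFun (fun k ω => α k * Y k ω) P :=
      hind.comp (fun k x => α k * x) fun k => measurable_const_mul _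
    have hSm : Measurable (fun ω => ∑ k ∈ s, α k * Y k ω) :=
      Finset.measurable_sum _ fun k _ => hm k
    have hSL : MemLp (fun ω => ∑ k ∈ s, α k * Y k ω) 2 P := memLp_finsetSum _ fun k _ => hL k
    have hS0 : ∫ ω, ∑ k ∈ s, α k * Y k ω ∂P = 0 := by
      rw [integral_finsetSum _ fun k _ => (hL k).integrable (by norm_num)]
      simp [integral_const_mul, h0]
    have hSv : ∫ ω, (∑ k ∈ s, α k * Y k ω) ^ 2 ∂P = 1 := by
      have hv := variance_of_integral_eq_zero hSm.aemeasurable hS0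
      rw [← hv]
      have := IndepFun.variance_sum (μ := P) (s := s) (X := fun k ω => α k * Y k ω)
        (fun k _ => hL k) (fun i _ j _ hij => hind'.indepFun hij)
      have e : (fun ω => ∑ k ∈ s, α k * Y k ω) = ∑ k ∈ s, fun ω => α k * Y k ω := by
        ext; simp
      rw [e, this, ← hα]
      refine Finset.sum_congr rfl fun k _ => ?_
      rw [variance_const_mul, h1, mul_one]
    refine measureReal_ge_of_integral_abs_ge hSm hSL hS0 hSv.le hc ?_
    have hprod : ‖charFun (P.map fun ω => ∑ k ∈ s, α k * Y k ω) u₀‖ ≤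
        Real.exp (-(u₀ ^ 2 / 4)) := by
      rw [(hind'.restrict _).charFun_map_fun_finsetSum_eq_prod fun k _ => (hm k).aemeasurable,
        Finset.prod_apply, norm_prod]
      have hb : ∀ k ∈ s, ‖charFun (P.map fun ω => α k * Y k ω) u₀‖ ≤
          Real.exp (-((α k * u₀) ^ 2 / 4)) := by
        intro k hk
        rw [charFun_map_mul_comp (hY k).aemeasurable]
        refine hchar k _ ?_
        -- Normalized weights keep `α k * u₀` inside the range where `hchar` applies.
        have : α k ^ 2 ≤ 1 := by
          rw [← hα]
          exact Finset.single_le_sum (f := fun k => α k ^ 2) (fun i _ => sq_nonneg _) hk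
        rw [abs_mul, abs_of_pos hu₀]
        exact mul_le_of_le_one_left hu₀.le ((sq_le_one_iff_abs_le_one _).1 this)
      refine (Finset.prod_le_prod (fun _ _ => norm_nonneg _) hb).trans ?_
      rw [← Real.exp_sum]
      refine (congrArg Real.exp ?_).le
      rw [Finset.sum_neg_distrib, ← Finset.sum_div]
      simp_rw [mul_pow]
      rw [← Finset.sum_mul, hα, one_mul]
    have hlow := norm_charFun_sub_one_le hSm (hSL.integrable (by norm_num)) u₀
    rw [abs_of_pos hu₀] at hlow
    have htri : (1 : ℝ) ≤ ‖charFun (P.map fun ω => ∑ k ∈ s, α k * Y k ω) u₀ - 1‖ +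
        ‖charFun (P.map fun ω => ∑ k ∈ s, α k * Y k ω) u₀‖ := by
      have := norm_le_norm_sub_add (1 : ℂ) (charFun (P.map fun ω => ∑ k ∈ s, α k * Y k ω) u₀)
      rwa [norm_one, norm_sub_rev] at this
    rw [hc_def, div_le_iff₀ hu₀]
    linarith
  -- The `1` serves the case of zero weights, where the event is the whole space.
  refine ⟨c / 4, min 1 (c ^ 2 / 16), by positivity, by positivity, fun s α => ?_⟩
  rcases (Finset.sum_nonneg fun k (_ : k ∈ s) => sq_nonneg (α k)).eq_or_lt' with hα | hα
  · refine (min_le_left _ _).trans ?_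
    have hz : ∀ k ∈ s, α k = 0 := fun k hk => by
      simpa using (Finset.sum_eq_zero_iff_of_nonneg fun k _ => sq_nonneg (α k)).1 hα k hk
    have : {ω | c / 4 * √(∑ k ∈ s, α k ^ 2) ≤ ∑ k ∈ s, α k * Y k ω} = Set.univ := by
      ext ω
      have : ∑ k ∈ s, α k * Y k ω = 0 := Finset.sum_eq_zero fun k hk => by rw [hz k hk, zero_mul]
      simp [this, hα]
    rw [this, probReal_univ]
  · refine (min_le_right _ _).trans ?_
    have hr := Real.sqrt_pos.2 hα
    set r := √(∑ k ∈ s, α k ^ 2) with hr_def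
    have hr2 : r ^ 2 = ∑ k ∈ s, α k ^ 2 := Real.sq_sqrt hα.le
    refine (key s (fun k => α k / r) ?_).trans (le_of_eq ?_)
    · simp_rw [div_pow]
      rw [← Finset.sum_div, ← hr2, div_self (by positivity)]
    · congr 1
      ext ω
      have : ∑ k ∈ s, α k / r * Y k ω = (∑ k ∈ s, α k * Y k ω) / r := by
        rw [Finset.sum_div]; exact Finset.sum_congr rfl fun k _ => by ring
      simp only [Set.mem_ofPred_eq]
      rw [this, le_div_iff₀ hr]

/-! ### Half-spaces under the population law -/

/-- Second moments of independent centered variables: a series `∑ b k ^ 2` that diverges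
gives halfspaces through `b` of arbitrarily small probability. -/
lemma measure_sum_mul_self_le {Ω : Type*} [MeasurableSpace Ω] {P : Measure Ω}
    [IsProbabilityMeasure P] {Y : ℕ → Ω → ℝ} (hind : iIndepFun Y P)
    (hY2 : ∀ k, MemLp (Y k) 2 P) (h0 : ∀ k, ∫ ω, Y k ω ∂P = 0)
    (h1 : ∀ k, variance (Y k) P = 1) {b : ℕ → ℝ} (s : Finset ℕ) (hb : 0 < ∑ k ∈ s, b k ^ 2) :
    P {ω | ∑ k ∈ s, b k * b k ≤ ∑ k ∈ s, b k * Y k ω} ≤ ENNReal.ofReal (∑ k ∈ s, b k ^ 2)⁻¹ := by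
  have hL : ∀ k, MemLp (fun ω => b k * Y k ω) 2 P := fun k => (hY2 k).const_mul _
  have hind' : iIndepFun (fun k ω => b k * Y k ω) P :=
    hind.comp (fun k x => b k * x) fun k => measurable_const_mul _
  have hSL : MemLp (fun ω => ∑ k ∈ s, b k * Y k ω) 2 P := memLp_finsetSum _ fun k _ => hL k
  have hS0 : ∫ ω, ∑ k ∈ s, b k * Y k ω ∂P = 0 := by
    rw [integral_finsetSum _ fun k _ => (hL k).integrable (by norm_num)]
    simp [integral_const_mul, h0]
  have hSv : variance (fun ω => ∑ k ∈ s, b k * Y k ω) P = ∑ k ∈ s, b k ^ 2 := by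
    have := IndepFun.variance_sum (μ := P) (s := s) (X := fun k ω => b k * Y k ω)
      (fun k _ => hL k) (fun i _ j _ hij => hind'.indepFun hij)
    have e : (fun ω => ∑ k ∈ s, b k * Y k ω) = ∑ k ∈ s, fun ω => b k * Y k ω := by
      ext; simp
    rw [e, this]
    refine Finset.sum_congr rfl fun k _ => ?_
    rw [variance_const_mul, h1, mul_one]
  -- The threshold equals the variance, so Chebyshev returns its reciprocal.
  have hch := meas_ge_le_variance_div_sq hSL hb
  rw [hSv, hS0] at hch
  refine (measure_mono fun ω hω => ?_).trans (hch.trans (le_of_eq ?_))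
  · simp only [Set.mem_ofPred_eq, sub_zero] at hω ⊢
    refine le_trans (le_of_eq ?_) (hω.trans (le_abs_self _))
    exact Finset.sum_congr rfl fun k _ => sq _
  · congr 1
    rw [sq, div_mul_cancel_left₀ hb.ne']

/-- If halfspaces in each finite set of coordinates have uniformly positive probability and weighted
sums are anti-concentrated, then halfspaces through a square summable `b` in all coordinates have
uniformly positive probability. -/
lemma exists_le_measure_sum_ge {Ω : Type*} [MeasurableSpace Ω] {P : Measure Ω}
    [IsProbabilityMeasure P] {Y : ℕ → Ω → ℝ} (hY : ∀ k, Measurable (Y k)) (hind : iIndepFun Y P)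
    {b : ℕ → ℝ} (hb : Summable fun k => b k ^ 2)
    (hhead : ∀ d : ℕ, 1 ≤ d → ∃ h : ℝ≥0∞, 0 < h ∧ ∀ α : ℕ → ℝ,
      h ≤ P {ω | ∑ k ∈ Finset.range d, α k * b k ≤ ∑ k ∈ Finset.range d, α k * Y k ω})
    (htail : ∃ ε p : ℝ, 0 < ε ∧ 0 < p ∧ ∀ (s : Finset ℕ) (α : ℕ → ℝ),
      p ≤ P.real {ω | ε * √(∑ k ∈ s, α k ^ 2) ≤ ∑ k ∈ s, α k * Y k ω}) :
    ∃ h : ℝ≥0∞, 0 < h ∧ ∀ (s : Finset ℕ) (α : ℕ → ℝ),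
      h ≤ P {ω | ∑ k ∈ s, α k * b k ≤ ∑ k ∈ s, α k * Y k ω} := by
  obtain ⟨ε, p, hε, hp, htail⟩ := htail
  -- The cut is made where every finite tail of `b` has norm below the anti-concentration constant
  -- `ε`.
  obtain ⟨s₀, hs₀⟩ := hb.vanishing (Iio_mem_nhds (by positivity : 0 < ε ^ 2))
  obtain ⟨d, hd1, hd⟩ : ∃ d, 1 ≤ d ∧ s₀ ⊆ Finset.range d := by
    obtain ⟨n, hn⟩ := s₀.exists_nat_subset_range
    exact ⟨n + 1, by omega, hn.trans (Finset.range_subset_range.2 (by omega))⟩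
  obtain ⟨h, hh, hhead⟩ := hhead d hd1
  refine ⟨h * ENNReal.ofReal p, ENNReal.mul_pos hh.ne' (by simpa using hp), fun s α' => ?_⟩
  -- Extending the weights by zero makes the head a sum over all of `range d`, as `hhead` requires,
  -- whatever `s` is.
  set α : ℕ → ℝ := fun k => if k ∈ s then α' k else 0 with hα_def
  set T := s \ Finset.range d with hT_def
  have hsplit : ∀ f : ℕ → ℝ, ∑ k ∈ s, α' k * f k =
      ∑ k ∈ Finset.range d, α k * f k + ∑ k ∈ T, α k * f k := by
    intro f
    have e1 : ∑ k ∈ s, α' k * f k = ∑ k ∈ s, α k * f k :=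
      Finset.sum_congr rfl fun k hk => by simp [hα_def, hk]
    have e2 : ∑ k ∈ Finset.range d, α k * f k = ∑ k ∈ s ∩ Finset.range d, α k * f k := by
      symm
      refine Finset.sum_subset Finset.inter_subset_right fun k hk hk' => ?_
      have : k ∉ s := fun hks => hk' (Finset.mem_inter.2 ⟨hks, hk⟩)
      simp [hα_def, this]
    rw [e1, e2, Finset.sum_inter_add_sum_sdiff]
  have hdisj : Disjoint (Finset.range d) T := Finset.disjoint_sdiff
  have hindep := hind.indepFun_finset _ _ hdisj hY
  have hg : ∀ U : Finset ℕ, Measurable fun x : U → ℝ => ∑ k : U, α k * x k := fun U =>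
    Finset.measurable_sum _ fun k _ => (measurable_pi_apply k).const_mul _
  have hindep' := hindep.comp (hg (Finset.range d)) (hg T)
  have hrew : ∀ U : Finset ℕ, ((fun x : U → ℝ => ∑ k : U, α k * x k) ∘
      fun ω (i : U) => Y i ω) = fun ω => ∑ k ∈ U, α k * Y k ω := fun U => by
    ext ω
    exact Finset.sum_coe_sort U fun k => α k * Y k ω
  rw [hrew, hrew] at hindep'
  have hmul := hindep'.measure_inter_preimage_eq_mul
    (Set.Ici (∑ k ∈ Finset.range d, α k * b k)) (Set.Ici (ε * √(∑ k ∈ T, α k ^ 2)))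
    measurableSet_Ici measurableSet_Ici
  have hb' : ∑ k ∈ T, α k * b k ≤ ε * √(∑ k ∈ T, α k ^ 2) := by
    refine (Real.sum_mul_le_sqrt_mul_sqrt _ _ _).trans ?_
    rw [mul_comm]
    refine mul_le_mul_of_nonneg_right ?_ (Real.sqrt_nonneg _)
    refine Real.sqrt_le_iff.2 ⟨hε.le, ?_⟩
    have := hs₀ T (Finset.disjoint_of_subset_right hd hdisj.symm)
    exact (Set.mem_Iio.1 this).le
  calc h * ENNReal.ofReal p
      ≤ P ((fun ω => ∑ k ∈ Finset.range d, α k * Y k ω) ⁻¹'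
          Set.Ici (∑ k ∈ Finset.range d, α k * b k)) *
        P ((fun ω => ∑ k ∈ T, α k * Y k ω) ⁻¹' Set.Ici (ε * √(∑ k ∈ T, α k ^ 2))) := by
        refine mul_le_mul' (hhead α) ?_
        rw [ENNReal.ofReal_le_iff_le_toReal (measure_ne_top _ _)]
        exact htail T α
    _ = _ := hmul.symm
    _ ≤ _ := by
        refine measure_mono fun ω hω => ?_
        simp only [Set.mem_inter_iff, Set.mem_preimage, Set.mem_Ici, Set.mem_ofPred_eq] at hω ⊢
        rw [hsplit, hsplit]
        linarith [hω.1, hω.2]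

/-- For independent coordinates, each of which lies on either side of `b k` with positive
probability, halfspaces through `b` in finitely many coordinates are uniformly non-negligible. -/
lemma exists_le_measure_sum_ge_of_pos {Ω : Type*} [MeasurableSpace Ω] {P : Measure Ω}
    {Y : ℕ → Ω → ℝ} (hind : iIndepFun Y P) {b : ℕ → ℝ}
    (hle : ∀ k, 0 < P {ω | b k ≤ Y k ω}) (hge : ∀ k, 0 < P {ω | Y k ω ≤ b k}) (s : Finset ℕ) :
    ∃ h : ℝ≥0∞, 0 < h ∧ ∀ α : ℕ → ℝ,
      h ≤ P {ω | ∑ k ∈ s, α k * b k ≤ ∑ k ∈ s, α k * Y k ω} := by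
  -- It suffices that each summand satisfies its own inequality. Only the sign of `α k` decides
  -- which side of `b k` is needed, so the minimum is uniform in `α`.
  refine ⟨∏ k ∈ s, min (P {ω | b k ≤ Y k ω}) (P {ω | Y k ω ≤ b k}),
    CanonicallyOrderedAdd.prod_pos.2 fun k _ => lt_min (hle k) (hge k), fun α => ?_⟩
  have hm : ∀ k ∈ s, MeasurableSet[MeasurableSpace.comap (Y k) inferInstance]
      {ω | α k * b k ≤ α k * Y k ω} := fun k _ =>
    ⟨{x | α k * b k ≤ α k * x}, measurableSet_le measurable_const (measurable_const_mul _), rfl⟩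
  calc _ ≤ ∏ k ∈ s, P {ω | α k * b k ≤ α k * Y k ω} := by
        refine Finset.prod_le_prod' fun k _ => ?_
        rcases le_total 0 (α k) with h | h
        · exact (min_le_left _ _).trans
            (measure_mono fun ω hω => mul_le_mul_of_nonneg_left hω h)
        · exact (min_le_right _ _).trans
            (measure_mono fun ω hω => mul_le_mul_of_nonpos_left hω h)
    _ = P (⋂ k ∈ s, {ω | α k * b k ≤ α k * Y k ω}) := (hind.meas_biInter hm).symm
    _ ≤ _ := by
        refine measure_mono fun ω hω => ?_
        simp only [Set.mem_iInter, Set.mem_ofPred_eq] at hω ⊢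
        exact Finset.sum_le_sum hω

/-! ### Sample points and empirical depth -/

/-- Second Borel–Cantelli for samples: if the sets `D k` are `μ`-independent with probabilities
bounded away from zero, then almost surely some `D k` contains the first `n` sample points. -/
lemma ae_exists_forall_mem {B Ω : Type*} [MeasurableSpace B] [MeasurableSpace Ω] {P : Measure Ω}
    [IsProbabilityMeasure P] {μ : Measure B} {Xs : ℕ → Ω → B} (hXs : ∀ j, Measurable (Xs j))
    (hXs_indep : iIndepFun Xs P) (hlaw : ∀ j, P.map (Xs j) = μ) {D : ℕ → Set B}
    (hD : ∀ k, MeasurableSet (D k)) (hDind : iIndepSet D μ)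
    (hlim : 0 < liminf (fun k => μ (D k)) atTop) (n : ℕ) :
    ∀ᵐ ω ∂P, ∃ k, ∀ j < n, Xs j ω ∈ D k := by
  set A : ℕ → Set Ω := fun k => ⋂ j ∈ Finset.range n, Xs j ⁻¹' D k with hA_def
  have hinter : ∀ C : Set B, MeasurableSet C →
      P (⋂ j ∈ Finset.range n, Xs j ⁻¹' C) = μ C ^ n := by
    intro C hC
    rw [hXs_indep.meas_biInter fun j _ => ⟨C, hC, rfl⟩]
    simp [← Measure.map_apply (hXs _) hC, hlaw]
  have hAm : ∀ k, MeasurableSet (A k) := fun k =>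
    Finset.measurableSet_biInter _ fun j _ => hXs j (hD k)
  -- Intersections over `k` and over sample points commute, so independence passes from `D` to `A`
  -- by taking `n`-th powers.
  have hAind : iIndepSet A P := by
    rw [iIndepSet_iff_meas_biInter hAm]
    intro s
    have : ⋂ k ∈ s, A k = ⋂ j ∈ Finset.range n, Xs j ⁻¹' (⋂ k ∈ s, D k) := by
      ext ω
      simp only [hA_def, Set.mem_iInter, Set.mem_preimage]
      exact ⟨fun h j hj k hk => h k hk j hj, fun h k hk j hj => h j hj k hk⟩
    rw [this, hinter _ (Finset.measurableSet_biInter _ fun k _ => hD k), hDind.meas_biInter,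
      ← Finset.prod_pow]
    exact Finset.prod_congr rfl fun k _ => (hinter _ (hD k)).symm
  have hsum : ∑' k, P (A k) = ∞ := by
    obtain ⟨δ, hδ, hδ'⟩ := exists_between hlim
    by_contra hne
    have h0 := ENNReal.tendsto_atTop_zero_of_tsum_ne_top hne
    have hev := eventually_lt_of_lt_liminf hδ'
    have hpos : 0 < δ ^ n := ENNReal.pow_pos hδ n
    obtain ⟨k, hk1, hk2⟩ := (hev.and (h0.eventually_lt_const hpos)).exists
    rw [hA_def] at hk2
    simp only [hinter _ (hD k)] at hk2
    exact absurd hk2 (not_lt.2 (pow_le_pow_left' hk1.le n))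
  have hone := measure_limsup_eq_one hAm hAind hsum
  have hae : ∀ᵐ ω ∂P, ω ∈ limsup A atTop := by
    rw [← prob_compl_eq_zero_iff (MeasurableSet.measurableSet_limsup hAm)] at hone
    exact hone
  filter_upwards [hae] with ω hω
  rw [mem_limsup_iff_frequently_mem] at hω
  obtain ⟨k, hk⟩ := hω.exists
  exact ⟨k, fun j hj => Set.mem_iInter₂.1 hk j (Finset.mem_range.2 hj)⟩

lemma depth_finiteCombinations {E : Type*} [MeasurableSpace E] (t : ℕ → E → ℝ) (a : E)
    (μ : Measure E) : depth (finiteCombinations t) a μ =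
      ⨅ α : ℕ →₀ ℝ, μ {x | ∑ k ∈ α.support, α k * t k a ≤ ∑ k ∈ α.support, α k * t k x} := by
  rw [depth, finiteCombinations, iInf_range]
  rfl

/-- Depth with respect to a law, in terms of the coordinates rescaled by positive constants. -/
lemma measure_map_finiteCombination {B Ω : Type*} [MeasurableSpace B] [MeasurableSpace Ω]
    {P : Measure Ω} {X : Ω → B} (hX : Measurable X) {t : ℕ → B → ℝ} (ht : ∀ k, Measurable (t k))
    {σ : ℕ → ℝ} (hσ : ∀ k, 0 < σ k) (a : B) (s : Finset ℕ) (α : ℕ → ℝ) :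
    P.map X {x | ∑ k ∈ s, α k * t k a ≤ ∑ k ∈ s, α k * t k x} =
      P {ω | ∑ k ∈ s, (α k * σ k) * (t k a / σ k) ≤
        ∑ k ∈ s, (α k * σ k) * (t k (X ω) / σ k)} := by
  have hm : Measurable fun x => ∑ k ∈ s, α k * t k x :=
    Finset.measurable_sum _ fun k _ => (ht k).const_mul _
  have e : ∀ x, ∑ k ∈ s, (α k * σ k) * (t k x / σ k) = ∑ k ∈ s, α k * t k x := fun x =>
    Finset.sum_congr rfl fun k _ => by have := (hσ k).ne'; field_simp
  rw [Measure.map_apply hX (measurableSet_le measurable_const hm)]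
  simp only [e]
  rfl

/-- If one functional is smaller than at `a` at all the first `n` sample points, then the empirical
depth of `a` vanishes. -/
lemma depth_empiricalMeasure_eq_zero {E : Type*} [MeasurableSpace E] {t : ℕ → E → ℝ}
    (ht : ∀ k, Measurable (t k)) {a : E} {Y : ℕ → E} {n k : ℕ}
    (h : ∀ j < n, t k (Y j) < t k a) :
    depth (finiteCombinations t) a (empiricalMeasure Y n) = 0 := by
  rw [depth_finiteCombinations]
  refine le_antisymm (iInf_le_of_le (Finsupp.single k 1) (le_of_eq ?_)) zero_le
  have hset : {x | ∑ i ∈ (Finsupp.single k (1 : ℝ)).support, Finsupp.single k (1 : ℝ) i * t i a ≤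
      ∑ i ∈ (Finsupp.single k (1 : ℝ)).support, Finsupp.single k (1 : ℝ) i * t i x} =
      {x | t k a ≤ t k x} := by
    rw [Finsupp.support_single _ one_ne_zero]
    simp
  have hz : ∀ j ∈ Finset.range n, Measure.dirac (Y j) {x | t k a ≤ t k x} = 0 := fun j hj => by
    rw [Measure.dirac_apply' _ (measurableSet_le measurable_const (ht k)),
      Set.indicator_of_notMem]
    simpa using h j (Finset.mem_range.1 hj)
  rw [hset, empiricalMeasure, Measure.smul_apply, Measure.finsetSum_apply,
    Finset.sum_eq_zero hz, smul_zero]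

/-! ### Consequences of (A-I), (A-II) and (A-III) -/

/-- Positive Tukey depth of the projections bounds halfspaces in finitely many coordinates. -/
lemma AssumptionI.exists_le_measure {B Ω : Type*} [MeasurableSpace B] [MeasurableSpace Ω]
    {P : Measure Ω} {X : Ω → B} (hX : Measurable X) {t : ℕ → B → ℝ} (ht : ∀ k, Measurable (t k))
    {σ : ℕ → ℝ} {a : B} (hI : AssumptionI t (P.map X) a) (d : ℕ) (hd : 1 ≤ d) :
    ∃ h : ℝ≥0∞, 0 < h ∧ ∀ α : ℕ → ℝ,
      h ≤ P {ω | ∑ k ∈ Finset.range d, α k * (t k a / σ k) ≤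
        ∑ k ∈ Finset.range d, α k * (t k (X ω) / σ k)} := by
  refine ⟨_, hI d hd, fun α => ?_⟩
  have hmeas : Measurable (firstCoords t d) := measurable_pi_lambda _ fun i => ht i
  set L : (Fin d → ℝ) →ₗ[ℝ] ℝ := ∑ i : Fin d, (α i / σ i) • LinearMap.proj i with hL
  have hLapp : ∀ x : B, L (firstCoords t d x) = ∑ k ∈ Finset.range d, α k * (t k x / σ k) := by
    intro x
    rw [Finset.sum_range, hL]
    simp only [LinearMap.coe_sum, Finset.sum_apply, LinearMap.smul_apply, LinearMap.proj_apply,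
      smul_eq_mul, firstCoords]
    exact Finset.sum_congr rfl fun i _ => by ring
  have hLm : Measurable L := (LinearMap.continuous_of_finiteDimensional L).measurable
  refine (iInf₂_le (fun x => L x) ⟨L, rfl⟩).trans (le_of_eq ?_)
  have hS : MeasurableSet {x | L (firstCoords t d a) ≤ L x} := measurableSet_le measurable_const hLm
  rw [Measure.map_apply hmeas hS, Measure.map_apply hX (hmeas hS)]
  simp only [← hLapp]
  rfl

/-- A law with an almost everywhere positive continuous density charges every set of positive
Lebesgue measure. -/
lemma measure_pos_of_map_eq_withDensity {Ω : Type*} [MeasurableSpace Ω] {P : Measure Ω}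
    {V : Ω → ℝ} (hV : Measurable V) {φ : ℝ → ℝ} (hφ : Measurable φ)
    (hlaw : P.map V = volume.withDensity fun x => ENNReal.ofReal (φ x))
    (hpos : ∀ᵐ x : ℝ, 0 < φ x) {S : Set ℝ} (hS : MeasurableSet S) (hvol : volume S ≠ 0) :
    0 < P (V ⁻¹' S) := by
  rw [← Measure.map_apply hV hS, hlaw, pos_iff_ne_zero]
  have hac : (volume : Measure ℝ) ≪ volume.withDensity fun x => ENNReal.ofReal (φ x) := by
    refine withDensity_absolutelyContinuous' hφ.ennreal_ofReal.aemeasurable ?_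
    filter_upwards [hpos] with x hx
    simpa using hx
  exact fun h => hvol (hac h)

lemma measurable_of_absolutelyContinuousOnInterval {φ : ℝ → ℝ}
    (h : ∀ a b : ℝ, AbsolutelyContinuousOnInterval φ a b) : Measurable φ := by
  refine Continuous.measurable (continuous_iff_continuousAt.2 fun x => ?_)
  refine (h (x - 1) (x + 1)).continuousOn.continuousAt ?_
  rw [Set.uIcc_of_le (by linarith)]
  exact Icc_mem_nhds (by linarith) (by linarith)

/-- Centered standardized variables with bounded kurtosis have characteristic functions with a
common Gaussian-type bound near the origin. -/
lemma exists_norm_charFun_le_of_kurtosis {Ω : Type*} [MeasurableSpace Ω] {P : Measure Ω}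
    [IsProbabilityMeasure P] {Y : ℕ → Ω → ℝ} (hY : ∀ k, Measurable (Y k))
    (hY2 : ∀ k, MemLp (Y k) 2 P) (h0 : ∀ k, ∫ ω, Y k ω ∂P = 0)
    (h1 : ∀ k, ∫ ω, Y k ω ^ 2 ∂P = 1) (h4 : ∀ k, Integrable (fun ω => Y k ω ^ 4) P)
    {C : ℝ} (hC : ∀ k, ∫ ω, Y k ω ^ 4 ∂P ≤ C) :
    ∃ u₀ : ℝ, 0 < u₀ ∧ ∀ k u, |u| ≤ u₀ → ‖charFun (P.map (Y k)) u‖ ≤ Real.exp (-(u ^ 2 / 4)) := by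
  have hCpos : 0 ≤ C := (integral_nonneg fun ω => by positivity).trans (hC 0)
  -- Chosen so that the cubic error `4 * (1 + C) * |u| ^ 3` is at most `u ^ 2 / 4`; it also forces
  -- `|u| ≤ 1`.
  refine ⟨1 / (16 * (1 + C)), by positivity, fun k u hu => ?_⟩
  rw [le_div_iff₀ (by positivity)] at hu
  have hu1 : |u| ≤ 1 := by nlinarith [abs_nonneg u, mul_nonneg (abs_nonneg u) hCpos]
  refine norm_le_exp_of_norm_sub_le hu1
    ((norm_charFun_sub_le_of_fourth_moment (hY k) (hY2 k) (h0 k) (h1 k) (h4 k) (hC k) u).trans ?_)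
  rw [← sq_abs u]
  nlinarith [mul_le_mul_of_nonneg_left hu (sq_nonneg |u|)]

/-- Identically distributed standardized variables have characteristic functions with a
common Gaussian-type bound near the origin. -/
lemma exists_norm_charFun_le_of_identDistrib {Ω : Type*} [MeasurableSpace Ω] {P : Measure Ω}
    [IsProbabilityMeasure P] {Y : ℕ → Ω → ℝ} (hY : ∀ k, Measurable (Y k))
    (h0 : ∀ k, ∫ ω, Y k ω ∂P = 0)
    (h1 : ∀ k, ∫ ω, Y k ω ^ 2 ∂P = 1) (hid : ∀ k, P.map (Y k) = P.map (Y 0)) :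
    ∃ u₀ : ℝ, 0 < u₀ ∧ ∀ k u, |u| ≤ u₀ → ‖charFun (P.map (Y k)) u‖ ≤ Real.exp (-(u ^ 2 / 4)) := by
  have ht := (taylor_charFun_two (hY 0).aemeasurable (h0 0) (h1 0)).def
    (by norm_num : (0 : ℝ) < 1 / 4)
  obtain ⟨ε, hε, hball⟩ := Metric.eventually_nhds_iff.1 ht
  refine ⟨min 1 (ε / 2), by positivity, fun k u hu => ?_⟩
  rw [hid k]
  refine norm_le_exp_of_norm_sub_le (hu.trans (min_le_left _ _)) ?_
  have := hball (y := u) (by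
    rw [Real.dist_eq, sub_zero]
    exact (hu.trans (min_le_right _ _)).trans_lt (by linarith))
  rw [Real.norm_of_nonneg (sq_nonneg u)] at this
  linarith

/-- Under assumption (A-III) the standardized variables are identically distributed and charge
both half-lines at every point. -/
lemma AssumptionIII.standardized {Ω : Type*} [MeasurableSpace Ω] {P : Measure Ω}
    [IsProbabilityMeasure P] {ξ : ℕ → Ω → ℝ} (hξ : ∀ k, Measurable (ξ k))
    {σ : ℕ → ℝ} (hσ_pos : ∀ k, 0 < σ k) (hσ : ∀ k, variance (ξ k) P = σ k ^ 2)
    (h : AssumptionIII ξ P) :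
    (∀ k, P.map (fun ω => ξ k ω / σ k) = P.map (fun ω => ξ 0 ω / σ 0)) ∧
      ∀ k x, 0 < P {ω | x ≤ ξ k ω / σ k} ∧ 0 < P {ω | ξ k ω / σ k ≤ x} := by
  obtain ⟨lam, φ, hlam, -, hlaw, hpos, hac, -, -⟩ := h
  have hVm : ∀ k, Measurable fun ω => ξ k ω / lam k := fun k => (hξ k).div_const _
  -- The variables `ξ k / lam k` share one law, hence one variance `(σ k / lam k) ^ 2`:
  -- standardizing differs from dividing by `lam k` by a common factor.
  have hratio : ∀ k, lam k / σ k = lam 0 / σ 0 := by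
    intro k
    have hv : ∀ k, variance (fun ω => ξ k ω / lam k) P = (σ k / lam k) ^ 2 := fun k => by
      have e : (fun ω => ξ k ω / lam k) = fun ω => (lam k)⁻¹ * ξ k ω := by
        ext; rw [div_eq_inv_mul]
      rw [e, variance_const_mul, hσ]
      field_simp
    have hid : IdentDistrib (fun ω => ξ k ω / lam k) (fun ω => ξ 0 ω / lam 0) P P :=
      ⟨(hVm k).aemeasurable, (hVm 0).aemeasurable, by rw [hlaw, hlaw]⟩
    have := hid.variance_eq
    rw [hv, hv, sq_eq_sq₀ (div_pos (hσ_pos _) (hlam _)).le (div_pos (hσ_pos _) (hlam _)).le] at this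
    rw [← inv_div, this, inv_div]
  have hY : ∀ k ω, ξ k ω / σ k = lam 0 / σ 0 * (ξ k ω / lam k) := fun k ω => by
    rw [← hratio k]
    have := (hlam k).ne'
    field_simp
  have hr : 0 < lam 0 / σ 0 := div_pos (hlam 0) (hσ_pos 0)
  constructor
  · have hmap : ∀ k, P.map (fun ω => ξ k ω / σ k) =
        (volume.withDensity fun x => ENNReal.ofReal (φ x)).map (lam 0 / σ 0 * ·) := fun k => by
      rw [← hlaw k, Measure.map_map (measurable_const_mul _) (hVm k)]
      congr 1
      ext ω
      exact hY k ω
    intro k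
    rw [hmap, hmap]
  · have hφ := measurable_of_absolutelyContinuousOnInterval hac
    intro k x
    constructor
    · have := measure_pos_of_map_eq_withDensity (hVm k) hφ (hlaw k) hpos
        (measurableSet_Ici (a := x / (lam 0 / σ 0))) (by simp)
      refine this.trans_le (measure_mono fun ω hω => ?_)
      simp only [Set.mem_preimage, Set.mem_Ici, Set.mem_ofPred_eq] at hω ⊢
      rw [hY, ← div_le_iff₀' hr]
      exact hω
    · have := measure_pos_of_map_eq_withDensity (hVm k) hφ (hlaw k) hpos
        (measurableSet_Iic (a := x / (lam 0 / σ 0))) (by simp)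
      refine this.trans_le (measure_mono fun ω hω => ?_)
      simp only [Set.mem_preimage, Set.mem_Iic, Set.mem_ofPred_eq] at hω ⊢
      rw [hY, ← le_div_iff₀' hr]
      exact hω

end HalfSpaceDepth

/-! ### The dichotomy -/

open HalfSpaceDepth in
theorem corollary1
    -- `B` is a real F-space with its Borel sets
    {B : Type*} [AddCommGroup B] [Module ℝ B] [MetricSpace B] [CompleteSpace B]
    [ContinuousSMul ℝ B] (hinv : ∀ x y z : B, dist (x + z) (y + z) = dist x y)
    [MeasurableSpace B] [BorelSpace B]
    {Ω : Type*} [MeasurableSpace Ω] (P : Measure Ω) [IsProbabilityMeasure P]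
    -- a random vector `X` and i.i.d. copies `Xs 0, Xs 1, …` of it
    (X : Ω → B) (hX : Measurable X)
    (Xs : ℕ → Ω → B) (hXs : ∀ j, Measurable (Xs j))
    (hXs_indep : iIndepFun Xs P) (hXs_ident : ∀ j, IdentDistrib (Xs j) X P P)
    -- Borel functionals with `t k (X)` independent, of mean zero and variance `σ k ^ 2` in `(0, ∞)`
    (t : ℕ → B → ℝ) (ht : ∀ k, Measurable (t k))
    (ht_indep : iIndepFun (fun k ω => t k (X ω)) P)
    (ht_memLp : ∀ k, MemLp (fun ω => t k (X ω)) 2 P)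
    (ht_mean : ∀ k, ∫ ω, t k (X ω) ∂P = 0)
    (σ : ℕ → ℝ) (hσ_pos : ∀ k, 0 < σ k)
    (hσ : ∀ k, variance (fun ω => t k (X ω)) P = σ k ^ 2)
    (hliminf : ∀ c : ℕ → ℝ, Tendsto (fun k => c k / σ k) atTop (𝓝 0) →
      0 < liminf (fun k => P {ω | t k (X ω) < c k}) atTop)
    (a : B)
    (hA : (AssumptionI t (P.map X) a ∧ AssumptionII (fun k ω => t k (X ω)) P) ∨
      AssumptionIII (fun k ω => t k (X ω)) P) :
    (Summable (fun k => t k a ^ 2 / σ k ^ 2) →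
      (∀ᵐ ω ∂P, ∀ n : ℕ, 1 ≤ n →
        depth (finiteCombinations t) a (empiricalMeasure (fun j => Xs j ω) n) = 0) ∧
      0 < depth (finiteCombinations t) a (P.map X) ∧
      (∀ᵐ ω ∂P, ¬ Tendsto
        (fun n => depth (finiteCombinations t) a (empiricalMeasure (fun j => Xs j ω) n))
        atTop (𝓝 (depth (finiteCombinations t) a (P.map X))))) ∧
    (¬ Summable (fun k => t k a ^ 2 / σ k ^ 2) →
      Tendsto (fun k => t k a / σ k) atTop (𝓝 0) →
      ∀ᵐ ω ∂P, Tendsto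
        (fun n => depth (finiteCombinations t) a (empiricalMeasure (fun j => Xs j ω) n))
        atTop (𝓝 (depth (finiteCombinations t) a (P.map X)))) := by

  set Y : ℕ → Ω → ℝ := fun k ω => t k (X ω) / σ k with hY_def
  set b : ℕ → ℝ := fun k => t k a / σ k with hb_def
  have hXm : ∀ k, Measurable fun ω => t k (X ω) := fun k => (ht k).comp hX
  have hYm : ∀ k, Measurable (Y k) := fun k => (hXm k).div_const _
  have hYind : iIndepFun Y P :=
    ht_indep.comp (fun k x => x / σ k) fun k => measurable_id.div_const _
  have hYeq : ∀ k, Y k = fun ω => (σ k)⁻¹ * t k (X ω) := fun k => by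
    ext; simp only [hY_def, div_eq_inv_mul]
  have hY2 : ∀ k, MemLp (Y k) 2 P := fun k => by
    rw [hYeq]; exact (ht_memLp k).const_mul _
  have hY0 : ∀ k, ∫ ω, Y k ω ∂P = 0 := fun k => by
    rw [hYeq, integral_const_mul, ht_mean, mul_zero]
  have hYv : ∀ k, variance (Y k) P = 1 := fun k => by
    rw [hYeq, variance_const_mul, hσ]
    have := (hσ_pos k).ne'
    field_simp
  have hYsq : ∀ k, ∫ ω, Y k ω ^ 2 ∂P = 1 := fun k => by
    rw [← hYv k, variance_of_integral_eq_zero (hYm k).aemeasurable (hY0 k)]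
  have hbsq : (fun k => t k a ^ 2 / σ k ^ 2) = fun k => b k ^ 2 := by
    ext k; simp only [hb_def, div_pow]
  have hdepth : depth (finiteCombinations t) a (P.map X) = ⨅ α : ℕ →₀ ℝ,
      P {ω | ∑ k ∈ α.support, (α k * σ k) * b k ≤ ∑ k ∈ α.support, (α k * σ k) * Y k ω} := by
    rw [depth_finiteCombinations]
    exact iInf_congr fun α => measure_map_finiteCombination hX ht hσ_pos a _ _
  -- Used in both regimes. The case `n = 0` is harmless: the empirical measure is then `∞ • 0 = 0`.
  have hempirical : Tendsto b atTop (𝓝 0) → ∀ᵐ ω ∂P, ∀ n : ℕ,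
      depth (finiteCombinations t) a (empiricalMeasure (fun j => Xs j ω) n) = 0 := by
    intro hb0
    have : IsProbabilityMeasure (P.map X) := Measure.isProbabilityMeasure_map hX.aemeasurable
    have hD : ∀ k, MeasurableSet {x | t k x < t k a} := fun k =>
      measurableSet_lt (ht k) measurable_const
    have hDP : ∀ k, P.map X {x | t k x < t k a} = P {ω | t k (X ω) < t k a} := fun k =>
      Measure.map_apply hX (hD k)
    have hDind : iIndepSet (fun k => {x | t k x < t k a}) (P.map X) := by
      rw [iIndepSet_iff_meas_biInter hD]
      intro s
      rw [Measure.map_apply hX (Finset.measurableSet_biInter _ fun k _ => hD k),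
        Set.preimage_iInter₂]
      simp only [hDP]
      exact ht_indep.meas_biInter (s := fun k => {ω | t k (X ω) < t k a})
        fun k _ => ⟨Set.Iio (t k a), measurableSet_Iio, rfl⟩
    rw [ae_all_iff]
    intro n
    filter_upwards [ae_exists_forall_mem hXs hXs_indep (fun j => (hXs_ident j).map_eq) hD hDind
      (by simpa only [hDP] using hliminf (fun k => t k a) hb0) n] with ω ⟨k, hk⟩
    exact depth_empiricalMeasure_eq_zero ht hk
  refine ⟨fun hsum => ?_, fun hsum hb0 => ?_⟩
  · rw [hbsq] at hsum
    have hb0 : Tendsto b atTop (𝓝 0) := by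
      have := hsum.tendsto_atTop_zero.sqrt
      simp only [Real.sqrt_sq_eq_abs, Real.sqrt_zero] at this
      exact (tendsto_zero_iff_abs_tendsto_zero _).2 this
    have hpos : 0 < depth (finiteCombinations t) a (P.map X) := by
      have hhead : ∀ d : ℕ, 1 ≤ d → ∃ h : ℝ≥0∞, 0 < h ∧ ∀ α : ℕ → ℝ,
          h ≤ P {ω | ∑ k ∈ Finset.range d, α k * b k ≤ ∑ k ∈ Finset.range d, α k * Y k ω} := by
        rcases hA with ⟨hI, -⟩ | hIII
        · exact hI.exists_le_measure hX ht
        · have h3 := (hIII.standardized hXm hσ_pos hσ).2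
          exact fun d _ => exists_le_measure_sum_ge_of_pos hYind (fun k => (h3 k (b k)).1)
            (fun k => (h3 k (b k)).2) _
      obtain ⟨u₀, hu₀, hchar⟩ : ∃ u₀ : ℝ, 0 < u₀ ∧ ∀ k u, |u| ≤ u₀ →
          ‖charFun (P.map (Y k)) u‖ ≤ Real.exp (-(u ^ 2 / 4)) := by
        rcases hA with ⟨-, c, hII⟩ | hIII
        · have e : ∀ k ω, Y k ω ^ 4 = (σ k ^ 4)⁻¹ * t k (X ω) ^ 4 := fun k ω => by
            simp only [hYeq, mul_pow, inv_pow]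
          refine exists_norm_charFun_le_of_kurtosis hYm hY2 hY0 hYsq (C := c)
            (fun k => ?_) (fun k => ?_)
          · simp only [e]
            exact (hII k).1.const_mul _
          · simp only [e]
            have hσ2 : ∫ ω, t k (X ω) ^ 2 ∂P = σ k ^ 2 := by
              rw [← hσ k, variance_of_integral_eq_zero (hXm k).aemeasurable (ht_mean k)]
            have := (hII k).2
            have hp := hσ_pos k
            rw [hσ2] at this
            rw [integral_const_mul, inv_mul_le_iff₀ (by positivity)]
            linarith
        · exact exists_norm_charFun_le_of_identDistrib hYm hY0 hYsq
            (hIII.standardized hXm hσ_pos hσ).1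
      obtain ⟨h, hh, hle⟩ := exists_le_measure_sum_ge hYm hYind hsum hhead
        (exists_le_measureReal_sum_ge hYm hYind hY2 hY0 hYv hu₀ hchar)
      rw [hdepth]
      exact hh.trans_le (le_iInf fun α => hle α.support fun k => α k * σ k)
    refine ⟨?_, hpos, ?_⟩
    · filter_upwards [hempirical hb0] with ω hω n _ using hω n
    · filter_upwards [hempirical hb0] with ω hω hlim
      simp only [hω] at hlim
      exact hpos.ne (tendsto_nhds_unique tendsto_const_nhds hlim)
  · rw [hbsq] at hsum
    have hzero : depth (finiteCombinations t) a (P.map X) = 0 := by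
      have hdiv : Tendsto (fun n => ∑ k ∈ Finset.range n, b k ^ 2) atTop atTop :=
        (not_summable_iff_tendsto_nat_atTop_of_nonneg fun k => sq_nonneg (b k)).1 hsum
      have hinv := ENNReal.tendsto_ofReal hdiv.inv_tendsto_atTop
      rw [ENNReal.ofReal_zero] at hinv
      refine le_antisymm (ge_of_tendsto hinv ?_) zero_le
      filter_upwards [hdiv.eventually_gt_atTop 0] with n hn
      rw [depth_finiteCombinations]
      refine le_trans ?_ (measure_sum_mul_self_le hYind hY2 hY0 hYv (Finset.range n) hn)
      -- These coefficients turn the functional into `∑ b k * Y k`. The support may be smaller than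
      -- `range n`, since `b k` can vanish, whence `hsumα`.
      set α : ℕ →₀ ℝ := Finsupp.onFinset (Finset.range n)
        (fun k => if k ∈ Finset.range n then b k / σ k else 0) (fun k hk => by
          by_contra h; exact hk (if_neg h)) with hα
      have hsumα : ∀ x, ∑ k ∈ α.support, α k * t k x =
          ∑ k ∈ Finset.range n, b k / σ k * t k x := fun x => by
        rw [Finset.sum_subset (Finsupp.support_onFinset_subset : α.support ⊆ Finset.range n)
          fun k _ hk => by rw [Finsupp.notMem_support_iff.1 hk, zero_mul]]
        exact Finset.sum_congr rfl fun k hk => by rw [hα, Finsupp.onFinset_apply, if_pos hk]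
      refine (iInf_le _ α).trans (le_of_eq ?_)
      simp only [hsumα]
      rw [measure_map_finiteCombination hX ht hσ_pos a]
      have e : ∀ k, b k / σ k * σ k = b k := fun k => div_mul_cancel₀ _ (hσ_pos k).ne'
      simp only [e]
      rfl
    filter_upwards [hempirical hb0] with ω hω
    simp only [hω, hzero]
    exact tendsto_const_nhds
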